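/- For a topological space $Y$ let $\mathcal O$ be the family of all open covers of $Y$; for $X\subseteq Y$ let $\mathcal O_X$ be the family of all covers of $X$ by sets open in $Y$; and let $\Omega$ be the family of all open $\omega$-covers of $Y$, i.e. open covers $\mathcal U$ of $Y$ with $Y\notin\mathcal U$ such that every finite subset of $Y$ is contained in some $U\in\mathcal U$. For a topological group $G$ let $\mathcal O_{nbd}$ be the family of all open covers of the form $\{x*U : x\in G\}$, where $U$ is an open neighborhood of the identity of $G$. For families $\mathcal A,\mathcal B$ of sets: $\mathsf S_1(\mathcal A,\mathcal B)$ says that for every sequence $(A_n : n<\omega)$ of elements of $\mathcal A$ there are $b_n\in A_n$ with $\{b_n : n<\omega\}\in\mathcal B$. $\mathsf G_1(\mathcal A,\mathcal B)$ is the game in which, in each inning $n<\omega$, ONE chooses $O_n\in\mathcal A$ and then TWO chooses $T_n\in O_n$; TWO wins the play if $\{T_n : n<\omega\}\in\mathcal B$, and otherwise ONE wins. For positive integers $n,k$, $\mathcal A\rightarrow(\mathcal B)^n_k$ says that for every $A\in\mathcal A$ and every $f:[A]^n\to\{1,\dots,k\}$ there are $B\subseteq A$ and $i\in\{1,\dots,k\}$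 such that $B\in\mathcal B$ and $f$ is constant with value $i$ on $[B]^n$, where $[A]^n$ is the set of $n$-element subsets of $A$. A topological group is Rothberger bounded if it satisfies $\mathsf S_1(\mathcal O_{nbd},\mathcal O)$. **Corollary.** Let $H$ be a subgroup of a $\sigma$-compact topological group $G$. The following are equivalent: 1. $G$ satisfies $\mathsf S_1(\mathcal O,\mathcal O_H)$, where $\mathcal O$ and $\mathcal O_H$ consist of families of open sets of $G$. 2. $H$, with the subspace topology, is Rothberger bounded. 3. ONE has no winning strategy in the game $\mathsf G_1(\mathcal O,\mathcal O_H)$ on $G$. 4. ONE has no winning strategy in the game $\mathsf G_1(\mathcal O_{nbd},\mathcal O)$ on the topological group $H$ with the subspace topology. 5. For each positive integer $k$, $\Omega\rightarrow(\mathcal O_H)^2_k$ holds, where $\Omega$ and $\mathcal O_H$ consist of families of open sets of $G$. -/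

import Mathlib

open scoped Pointwise

/-- The selection principle `S₁(𝒜, ℬ)`. -/
def SelectOne {α : Type*} (𝒜 ℬ : Set (Set α)) : Prop :=
  ∀ A : ℕ → Set α, (∀ n, A n ∈ 𝒜) →
    ∃ b : ℕ → α, (∀ n, b n ∈ A n) ∧ Set.range b ∈ ℬ

/-- A strategy of player ONE in the game `G₁(𝒜, ℬ)`: it assigns to the finite sequence
of the moves made so far by TWO the next move of ONE, a member of `𝒜`. -/
abbrev StrategyOne {α : Type*} (𝒜 : Set (Set α)) : Type _ := List α → 𝒜

/-- The sequence `T` of moves of TWO is legal against the strategy `F` of ONE: in every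
inning `n`, TWO picks an element of the answer of `F` to `(T 0, …, T (n - 1))`. -/
def StrategyOne.IsPlay {α : Type*} {𝒜 : Set (Set α)} (F : StrategyOne 𝒜) (T : ℕ → α) : Prop :=
  ∀ n, T n ∈ (F (List.ofFn fun i : Fin n => T i)).1

/-- ONE has a winning strategy in the game `G₁(𝒜, ℬ)` of length `ω`, where TWO wins a play
if and only if the set of the moves of TWO is a member of `ℬ`. -/
def OneHasWinningStrategy {α : Type*} (𝒜 ℬ : Set (Set α)) : Prop :=
  ∃ F : StrategyOne 𝒜, ∀ T : ℕ → α, F.IsPlay T → Set.range T ∉ ℬ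

/-- The set `[A]ⁿ` of the `n`-element subsets of `A`. -/
def subsetsOfCard {α : Type*} (A : Set α) (n : ℕ) : Set (Finset α) :=
  {s | (s : Set α) ⊆ A ∧ s.card = n}

/-- The partition relation `𝒜 → (ℬ)ⁿₖ`. -/
def PartitionRelation {α : Type*} (𝒜 ℬ : Set (Set α)) (n k : ℕ) : Prop :=
  ∀ A ∈ 𝒜, ∀ f : subsetsOfCard A n → Fin k,
    ∃ B ⊆ A, B ∈ ℬ ∧ ∃ i : Fin k, ∀ s : subsetsOfCard A n, s.1 ∈ subsetsOfCard B n → f s = i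

/-- `𝒪_X`: the covers of the subset `X` of `Y` by sets open in `Y`. -/
def openCoversOf {Y : Type*} [TopologicalSpace Y] (X : Set Y) : Set (Set (Set Y)) :=
  {𝒰 | (∀ U ∈ 𝒰, IsOpen U) ∧ X ⊆ ⋃₀ 𝒰}

/-- `𝒪`: the open covers of the space `Y`. -/
def openCovers (Y : Type*) [TopologicalSpace Y] : Set (Set (Set Y)) :=
  {𝒰 | (∀ U ∈ 𝒰, IsOpen U) ∧ ⋃₀ 𝒰 = Set.univ}

/-- `Ω`: the open `ω`-covers of the space `Y`. -/
def omegaCovers (Y : Type*) [TopologicalSpace Y] : Set (Set (Set Y)) :=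
  {𝒰 | 𝒰 ∈ openCovers Y ∧ Set.univ ∉ 𝒰 ∧ ∀ F : Set Y, F.Finite → ∃ U ∈ 𝒰, F ⊆ U}

/-- `𝒪_nbd`: the open covers of a topological group of the form `{x * U : x ∈ G}`,
where `U` is an open neighborhood of the identity. -/
def nbdCovers (G : Type*) [Group G] [TopologicalSpace G] : Set (Set (Set G)) :=
  {𝒰 | ∃ U : Set G, IsOpen U ∧ (1 : G) ∈ U ∧ 𝒰 = Set.range fun x : G => x • U}

/-- A topological group is Rothberger bounded if it satisfies `S₁(𝒪_nbd, 𝒪)`. -/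
def IsRothbergerBounded (G : Type*) [Group G] [TopologicalSpace G] : Prop :=
  SelectOne (nbdCovers G) (openCovers G)

open Set Filter Topology

/-! The core is that Rothberger boundedness of `H` defeats every strategy of ONE. On a compact
piece, a Lebesgue number argument (`IsCompact.exists_finite_translates_subset`) gives finitely many
members of ONE's cover and a neighborhood `V` such that each translate `x * V` lies, within the
piece, in one of them. If TWO uses only these members, each inning has finitely many positions;
intersecting their neighborhoods gives a sequence independent of the play, to which boundedness
applies (`IsRothbergerBounded.exists_isPlay`).

For the partition relation, an ultrafilter on the `ω`-cover guides ONE, and a play that ONE loses is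
a homogeneous cover. Conversely, a 2-coloring of punctured unions of translates gives back the
translates covering `H`. -/

/-- If `S₁(𝒜, ℬ)` fails, playing a counterexample is a winning strategy for ONE. -/
theorem selectOne_of_not_oneHasWinningStrategy {α : Type*} {𝒜 ℬ : Set (Set α)}
    (h : ¬ OneHasWinningStrategy 𝒜 ℬ) : SelectOne 𝒜 ℬ := by
  intro A hA
  by_contra hcon
  push Not at hcon
  refine h ⟨fun l => ⟨A l.length, hA _⟩, fun T hT => hcon T fun n => ?_⟩
  simpa using hT n

/-- Rothberger boundedness in terms of neighborhoods of the identity. -/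
theorem IsRothbergerBounded.exists_translates {H : Type*} [Group H] [TopologicalSpace H]
    (hH : IsRothbergerBounded H) (V : ℕ → Set H) (hV : ∀ n, V n ∈ 𝓝 (1 : H)) :
    ∃ x : ℕ → H, ∀ h, ∃ n, ∃ v ∈ V n, h = x n * v := by
  obtain ⟨b, hb, -, hcov⟩ := hH (fun n => range fun x : H => x • interior (V n))
    fun n => ⟨interior (V n), isOpen_interior, mem_interior_iff_mem_nhds.2 (hV n), rfl⟩
  choose x hx using hb
  refine ⟨x, fun h => ?_⟩
  obtain ⟨_, ⟨n, rfl⟩, hn⟩ : h ∈ ⋃₀ range b := hcov ▸ mem_univ h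
  rw [← hx n] at hn
  obtain ⟨v, hv, rfl⟩ := hn
  exact ⟨n, v, interior_subset hv, rfl⟩

/-! ### Defeating a strategy of ONE -/

/-- The positions of length `n` in which TWO has only chosen from prescribed sets. -/
def restrictedPositions {α : Type*} (M : ℕ → List α → Set α) : ℕ → Set (List α)
  | 0 => {[]}
  | n + 1 => ⋃ σ ∈ restrictedPositions M n, (fun U => σ ++ [U]) '' M n σ

theorem restrictedPositions_finite {α : Type*} {M : ℕ → List α → Set α}
    (hM : ∀ n σ, (M n σ).Finite) (n : ℕ) : (restrictedPositions M n).Finite := by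
  induction n with
  | zero => exact finite_singleton _
  | succ n ih => exact ih.biUnion fun σ _ => (hM n σ).image _

/-- The position reached after `n` innings when TWO moves according to `p`. -/
def positionAfter {α : Type*} (p : ℕ → List α → α) : ℕ → List α
  | 0 => []
  | n + 1 => positionAfter p n ++ [p n (positionAfter p n)]

theorem positionAfter_eq_ofFn {α : Type*} (p : ℕ → List α → α) (n : ℕ) :
    positionAfter p n = List.ofFn fun i : Fin n => p i (positionAfter p i) := by
  induction n with
  | zero => rfl
  | succ n ih =>
    rw [List.ofFn_succ_last, positionAfter]
    simp [← ih]

theorem positionAfter_mem {α : Type*} {M : ℕ → List α → Set α} {p : ℕ → List α → α}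
    (hp : ∀ n σ, p n σ ∈ M n σ) (n : ℕ) : positionAfter p n ∈ restrictedPositions M n := by
  induction n with
  | zero => rfl
  | succ n ih => exact mem_biUnion ih ⟨_, hp n _, rfl⟩

/-- If, up to a small translate, the members of `𝒜` can be reduced to finite families on each
of countably many pieces of a Rothberger bounded group, then TWO can defeat any strategy. -/
theorem IsRothbergerBounded.exists_isPlay {H Y : Type*} [Group H] [TopologicalSpace H]
    (hH : IsRothbergerBounded H) (e : H → Y) {𝒜 : Set (Set (Set Y))} (K : ℕ → Set H)
    (hK : ∀ h, ∃ m, h ∈ K m)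
    (h𝒜 : ∀ A ∈ 𝒜, ∀ m, ∃ S : Set (Set Y), S.Finite ∧ S ⊆ A ∧
      ∃ V ∈ 𝓝 (1 : H), ∀ x, ∃ U ∈ S, ∀ v ∈ V, x * v ∈ K m → e (x * v) ∈ U)
    (F : StrategyOne 𝒜) :
    ∃ T : ℕ → Set Y, F.IsPlay T ∧ ∀ h, ∃ n, e h ∈ T n := by
  choose S hSfin hSA V hV hSV using fun (σ : List (Set Y)) m => h𝒜 (F σ).1 (F σ).2 m
  let M : ℕ → List (Set Y) → Set (Set Y) := fun n σ => S σ n.unpair.1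
  -- Finitely many positions can occur in inning `n`, so one neighborhood serves them all.
  let W : ℕ → Set H := fun n => ⋂ σ ∈ restrictedPositions M n, V σ n.unpair.1
  have hW n : W n ∈ 𝓝 (1 : H) :=
    (biInter_mem (restrictedPositions_finite (fun n σ => hSfin σ _) n)).2 fun σ _ => hV σ _
  -- Boundedness is used once per piece `m`, on the innings `Nat.pair m n` reserved for it.
  choose x hx using fun m => hH.exists_translates (fun n => W (Nat.pair m n)) fun n => hW _
  choose p hpM hp using fun (n : ℕ) σ => hSV σ n.unpair.1 (x n.unpair.1 n.unpair.2)
  refine ⟨fun n => p n (positionAfter p n), fun n => ?_, fun h => ?_⟩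
  · rw [← positionAfter_eq_ofFn]
    exact hSA _ _ (hpM n _)
  · obtain ⟨m, hm⟩ := hK h
    obtain ⟨n, v, hv, rfl⟩ := hx m h
    refine ⟨Nat.pair m n, ?_⟩
    have hvV := mem_iInter₂.1 hv _ (positionAfter_mem (M := M) hpM (Nat.pair m n))
    have := hp (Nat.pair m n) (positionAfter p (Nat.pair m n)) v hvV
    simp only [Nat.unpair_pair] at this
    exact this hm

/-! ### Compactness and translates in topological groups -/

section TopologicalGroup

variable {G : Type*} [Group G] [TopologicalSpace G] [IsTopologicalGroup G]

theorem exists_nhds_one_inv_mul_mem {U : Set G} (hU : U ∈ 𝓝 (1 : G)) :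
    ∃ V : Set G, IsOpen V ∧ (1 : G) ∈ V ∧ ∀ v ∈ V, ∀ w ∈ V, v⁻¹ * w ∈ U := by
  have h : Tendsto (fun q : G × G => q.1⁻¹ * q.2) (𝓝 1 ×ˢ 𝓝 1) (𝓝 1) := by
    have : Continuous fun q : G × G => q.1⁻¹ * q.2 := by fun_prop
    simpa [nhds_prod_eq] using this.tendsto (1, 1)
  obtain ⟨V, hV, hVU⟩ := mem_prod_same_iff.1 (h hU)
  obtain ⟨W, hWV, hW, h1⟩ := mem_nhds_iff.1 hV
  exact ⟨W, hW, h1, fun v hv w hw => hVU (mk_mem_prod (hWV hv) (hWV hw))⟩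

/-- A Lebesgue number lemma for compact subsets of topological groups. -/
theorem IsCompact.exists_finite_nhds_one {K : Set G} (hK : IsCompact K) {A : Set (Set G)}
    (hA : A ∈ openCovers G) :
    ∃ S : Set (Set G), S.Finite ∧ S ⊆ A ∧
      ∃ V ∈ 𝓝 (1 : G), ∀ z ∈ K, ∃ U ∈ S, ∀ v ∈ V, z * v ∈ U := by
  refine hK.induction_on (p := fun K => ∃ S : Set (Set G), S.Finite ∧ S ⊆ A ∧
      ∃ V ∈ 𝓝 (1 : G), ∀ z ∈ K, ∃ U ∈ S, ∀ v ∈ V, z * v ∈ U) ?_ ?_ ?_ ?_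
  · exact ⟨∅, finite_empty, empty_subset _, univ, univ_mem, by simp⟩
  · rintro s t hst ⟨S, hS, hSA, V, hV, h⟩
    exact ⟨S, hS, hSA, V, hV, fun z hz => h z (hst hz)⟩
  · rintro s t ⟨S, hS, hSA, V, hV, h⟩ ⟨S', hS', hSA', V', hV', h'⟩
    refine ⟨S ∪ S', hS.union hS', union_subset hSA hSA', V ∩ V', inter_mem hV hV', ?_⟩
    rintro z (hz | hz)
    · obtain ⟨U, hU, hz⟩ := h z hz
      exact ⟨U, Or.inl hU, fun v hv => hz v hv.1⟩
    · obtain ⟨U, hU, hz⟩ := h' z hz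
      exact ⟨U, Or.inr hU, fun v hv => hz v hv.2⟩
  · intro p hp
    obtain ⟨U, hU, hpU⟩ : p ∈ ⋃₀ A := hA.2 ▸ mem_univ p
    have h : Tendsto (fun q : G × G => q.1 * q.2) (𝓝 p ×ˢ 𝓝 1) (𝓝 p) := by
      simpa [nhds_prod_eq] using (continuous_mul (M := G)).tendsto (p, 1)
    obtain ⟨N, hN, V, hV, hNV⟩ := mem_prod_iff.1 (h ((hA.1 U hU).mem_nhds hpU))
    exact ⟨N, mem_nhdsWithin_of_mem_nhds hN, {U}, finite_singleton U, singleton_subset_iff.2 hU,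
      V, hV, fun z hz => ⟨U, rfl, fun v hv => hNV (mk_mem_prod hz hv)⟩⟩

/-- The center `x` need not lie in `K`: if `x * W` meets `K` at `z` and `W⁻¹ * W ⊆ V`, then `x * W ⊆
z * V`. When it misses `K`, the spare member `U₀` serves. -/
theorem IsCompact.exists_finite_translates_subset {K : Set G} (hK : IsCompact K)
    {A : Set (Set G)} (hA : A ∈ openCovers G) :
    ∃ S : Set (Set G), S.Finite ∧ S ⊆ A ∧
      ∃ V ∈ 𝓝 (1 : G), ∀ x, ∃ U ∈ S, ∀ v ∈ V, x * v ∈ K → x * v ∈ U := by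
  obtain ⟨S, hS, hSA, V, hV, h⟩ := hK.exists_finite_nhds_one hA
  obtain ⟨U₀, hU₀, -⟩ : (1 : G) ∈ ⋃₀ A := hA.2 ▸ mem_univ 1
  obtain ⟨W, hW, h1, hWV⟩ := exists_nhds_one_inv_mul_mem hV
  refine ⟨insert U₀ S, hS.insert _, insert_subset hU₀ hSA, W, hW.mem_nhds h1, fun x => ?_⟩
  by_cases hx : ∃ w ∈ W, x * w ∈ K
  · obtain ⟨w, hw, hxw⟩ := hx
    obtain ⟨U, hU, hz⟩ := h _ hxw
    refine ⟨U, Or.inr hU, fun v hv _ => ?_⟩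
    simpa [mul_assoc] using hz _ (hWV w hw v hv)
  · exact ⟨U₀, Or.inl rfl, fun v hv hxv => (hx ⟨v, hv, hxv⟩).elim⟩

theorem range_smul_mem_openCovers {W : Set G} (hW : IsOpen W) (h1 : (1 : G) ∈ W) :
    (range fun g : G => g • W) ∈ openCovers G := by
  refine ⟨?_, eq_univ_of_forall fun g => ⟨g • W, ⟨g, rfl⟩, 1, h1, mul_one g⟩⟩
  rintro _ ⟨g, rfl⟩
  exact hW.smul g

/-- A translate of a small set in `G` meets `H` in a subset of a translate by an element
of `H`. -/
theorem Subgroup.exists_forall_mem_translate {G : Type*} [Group G] (H : Subgroup G) {V : Set H} {W : Set G}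
    (hWV : ∀ v ∈ W, ∀ w ∈ W, ∀ h : H, (h : G) = v⁻¹ * w → h ∈ V) (g : G) :
    ∃ x : H, ∀ h : H, (h : G) ∈ g • W → h ∈ x • V := by
  by_cases hg : ∃ x : H, (x : G) ∈ g • W
  · obtain ⟨x, v, hv, hx⟩ := hg
    refine ⟨x, ?_⟩
    rintro h ⟨w, hw, hh⟩
    refine ⟨x⁻¹ * h, hWV v hv w hw _ ?_, by simp⟩
    simp only [smul_eq_mul] at hx hh
    simp [← hx, ← hh, mul_assoc]
  · exact ⟨1, fun h hh => (hg ⟨h, hh⟩).elim⟩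

theorem Subgroup.exists_open_inv_mul_mem (H : Subgroup G) {V : Set H} (hV : V ∈ 𝓝 (1 : H)) :
    ∃ W : Set G, IsOpen W ∧ (1 : G) ∈ W ∧
      ∀ v ∈ W, ∀ w ∈ W, ∀ h : H, (h : G) = v⁻¹ * w → h ∈ V := by
  obtain ⟨U, hU, hUV⟩ := mem_nhds_subtype _ _ _ |>.1 hV
  obtain ⟨W, hW, h1, hWU⟩ := exists_nhds_one_inv_mul_mem (G := G) hU
  exact ⟨W, hW, h1, fun v hv w hw h hh => hUV (show (h : G) ∈ U from hh ▸ hWU v hv w hw)⟩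

/-- Centers outside `H` are harmless: after shrinking the neighborhoods they can be moved into `H`.
-/
theorem Subgroup.isRothbergerBounded_of_translates (H : Subgroup G)
    (h : ∀ W : ℕ → Set G, (∀ n, IsOpen (W n)) → (∀ n, (1 : G) ∈ W n) →
      ∃ g : ℕ → G, ∀ x ∈ H, ∃ n, x ∈ g n • W n) :
    IsRothbergerBounded H := by
  intro A hA
  choose V hV h1 hAV using hA
  choose W hW hW1 hWV using fun n => H.exists_open_inv_mul_mem ((hV n).mem_nhds (h1 n))
  obtain ⟨g, hg⟩ := h W hW hW1
  choose x hx using fun n => H.exists_forall_mem_translate (hWV n) (g n)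
  refine ⟨fun n => x n • V n, fun n => hAV n ▸ ⟨x n, rfl⟩, ?_, eq_univ_of_forall fun y => ?_⟩
  · rintro _ ⟨n, rfl⟩
    exact (hV n).smul _
  · obtain ⟨n, hn⟩ := hg y y.2
    exact ⟨_, ⟨n, rfl⟩, hx n y hn⟩

theorem Subgroup.isRothbergerBounded_of_selectOne (H : Subgroup G)
    (h : SelectOne (openCovers G) (openCoversOf (H : Set G))) : IsRothbergerBounded H := by
  refine H.isRothbergerBounded_of_translates fun W hW h1 => ?_
  obtain ⟨b, hb, -, hcov⟩ := h (fun n => range fun g : G => g • W n)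
    fun n => range_smul_mem_openCovers (hW n) (h1 n)
  choose g hg using hb
  refine ⟨g, fun x hx => ?_⟩
  obtain ⟨_, ⟨n, rfl⟩, hn⟩ := hcov hx
  rw [← hg n] at hn
  exact ⟨n, hn⟩

theorem Subgroup.exists_finite_translates_subset (H : Subgroup G) {K : Set G}
    (hK : IsCompact K) {A : Set (Set G)} (hA : A ∈ openCovers G) :
    ∃ S : Set (Set G), S.Finite ∧ S ⊆ A ∧ ∃ V ∈ 𝓝 (1 : H), ∀ x : H, ∃ U ∈ S,
      ∀ v ∈ V, x * v ∈ ((↑) ⁻¹' K : Set H) → ((x * v : H) : G) ∈ U := by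
  obtain ⟨S, hS, hSA, V, hV, h⟩ := hK.exists_finite_translates_subset hA
  refine ⟨S, hS, hSA, (↑) ⁻¹' V, continuous_subtype_val.continuousAt.preimage_mem_nhds hV,
    fun x => ?_⟩
  obtain ⟨U, hU, hxU⟩ := h x
  exact ⟨U, hU, fun v hv hvK => hxU v hv hvK⟩

theorem Subgroup.not_oneHasWinningStrategy_openCovers [SigmaCompactSpace G] (H : Subgroup G)
    (hH : IsRothbergerBounded H) :
    ¬ OneHasWinningStrategy (openCovers G) (openCoversOf (H : Set G)) := by
  rintro ⟨F, hF⟩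
  obtain ⟨T, hT, hcov⟩ := hH.exists_isPlay ((↑) : H → G)
    (fun m => ((↑) : H → G) ⁻¹' compactCovering G m)
    (fun h => exists_mem_compactCovering (h : G))
    (fun A hA m => H.exists_finite_translates_subset (isCompact_compactCovering G m) hA) F
  refine hF T hT ⟨?_, fun h hh => ?_⟩
  · rintro _ ⟨n, rfl⟩
    exact (F _).2.1 _ (hT n)
  · obtain ⟨n, hn⟩ := hcov ⟨h, hh⟩
    exact ⟨_, ⟨n, rfl⟩, hn⟩

/-- `H` need not be closed, so compactness is applied in `G` to translates of some `W`, which are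
then recentered in `H`. -/
theorem Subgroup.not_oneHasWinningStrategy_nbdCovers [SigmaCompactSpace G] (H : Subgroup G)
    (hH : IsRothbergerBounded H) :
    ¬ OneHasWinningStrategy (nbdCovers H) (openCovers H) := by
  rintro ⟨F, hF⟩
  obtain ⟨T, hT, hcov⟩ := hH.exists_isPlay (id : H → H)
    (𝒜 := nbdCovers H) (fun m => ((↑) : H → G) ⁻¹' compactCovering G m)
    (fun h => exists_mem_compactCovering (h : G))
    (by
      rintro _ ⟨V, hV, h1, rfl⟩ m
      obtain ⟨W, hW, hW1, hWV⟩ := H.exists_open_inv_mul_mem (hV.mem_nhds h1)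
      obtain ⟨S, hS, hSA, N, hN, h⟩ := H.exists_finite_translates_subset
        (isCompact_compactCovering G m) (range_smul_mem_openCovers hW hW1)
      choose! g hg using fun U (hU : U ∈ S) => hSA hU
      choose y hy using H.exists_forall_mem_translate hWV
      refine ⟨(fun U => y (g U) • V) '' S, hS.image _, ?_, N, hN, fun x => ?_⟩
      · rintro _ ⟨U, -, rfl⟩
        exact ⟨_, rfl⟩
      · obtain ⟨U, hU, hxU⟩ := h x
        refine ⟨_, ⟨U, hU, rfl⟩, fun v hv hvK => hy (g U) _ ?_⟩
        have hgU : g U • W = U := hg U hU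
        rw [hgU]
        exact hxU v hv hvK) F
  refine hF T hT ⟨?_, eq_univ_of_forall fun h => ?_⟩
  · rintro _ ⟨n, rfl⟩
    obtain ⟨V, hV, -, hFV⟩ := (F (List.ofFn fun i : Fin n => T i)).2
    obtain ⟨x, hx⟩ := hFV ▸ hT n
    exact hx ▸ hV.smul x
  · obtain ⟨n, hn⟩ := hcov h
    exact ⟨_, ⟨n, rfl⟩, hn⟩

end TopologicalGroup

/-! ### From the game to the partition relation -/

/-- An `ω`-cover carries an ultrafilter all of whose members are open covers and none of whose
members is a singleton. -/
theorem exists_ultrafilter_of_mem_omegaCovers {Y : Type*} [TopologicalSpace Y] {A : Set (Set Y)}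
    (hA : A ∈ omegaCovers Y) :
    ∃ D : Ultrafilter (Set Y), A ∈ D ∧ (∀ y, {U | y ∈ U} ∈ D) ∧ ∀ U ∈ A, {U}ᶜ ∈ D := by
  let L : Filter (Set Y) := ⨅ I : Finset Y, 𝓟 {U ∈ A | (I : Set Y) ⊆ U}
  have hL : L.NeBot := by
    classical
    refine iInf_neBot_of_directed' (fun I J => ⟨I ∪ J, ?_, ?_⟩) fun I => ?_
    · exact principal_mono.2 fun U hU => ⟨hU.1, fun y hy => hU.2 (by simp_all)⟩
    · exact principal_mono.2 fun U hU => ⟨hU.1, fun y hy => hU.2 (by simp_all)⟩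
    · obtain ⟨U, hU, hIU⟩ := hA.2.2 I I.finite_toSet
      exact principal_neBot_iff.2 ⟨U, hU, hIU⟩
  have hmem (I : Finset Y) : {U ∈ A | (I : Set Y) ⊆ U} ∈ Ultrafilter.of L :=
    Ultrafilter.of_le L (mem_iInf_of_mem I (mem_principal_self _))
  have hpt (y : Y) : {U : Set Y | y ∈ U} ∈ Ultrafilter.of L :=
    mem_of_superset (hmem {y}) fun U hU => hU.2 (by simp)
  refine ⟨Ultrafilter.of L, mem_of_superset (hmem ∅) fun U hU => hU.1, hpt, fun U hU => ?_⟩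
  obtain ⟨y, hy⟩ := (ne_univ_iff_exists_notMem U).1 fun h => hA.2.1 (h ▸ hU)
  refine mem_of_superset (hpt y) ?_
  rintro V hV rfl
  exact hy hV

theorem Ultrafilter.exists_fiber_mem {α ι : Type*} [Finite ι] (D : Ultrafilter α) (c : α → ι) :
    ∃ i, {a | c a = i} ∈ D := by
  have h : (⋃ i ∈ (univ : Set ι), {a | c a = i}) ∈ D := by
    rw [eq_univ_of_forall fun a => mem_biUnion (mem_univ (c a)) rfl]
    exact univ_mem
  obtain ⟨i, -, hi⟩ := (Ultrafilter.finite_biUnion_mem_iff finite_univ).1 h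
  exact ⟨i, hi⟩

/-- Let `d U` be the color of `{U, V}` for `D`-almost all `V`, and `i` the `D`-almost sure value of
`d`. ONE offers the `V` with `d V = i` that have color `i` with all earlier moves; this set is in
`D`, hence a cover. -/
theorem partitionRelation_of_not_oneHasWinningStrategy {Y : Type*} [TopologicalSpace Y]
    {X : Set Y} (h : ¬ OneHasWinningStrategy (openCovers Y) (openCoversOf X)) {k : ℕ}
    (hk : 0 < k) : PartitionRelation (omegaCovers Y) (openCoversOf X) 2 k := by
  classical
  intro A hA f
  obtain ⟨D, hAD, hpt, hsing⟩ := exists_ultrafilter_of_mem_omegaCovers hA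
  let c : Set Y → Set Y → Fin k := fun U V =>
    if hUV : ({U, V} : Finset (Set Y)) ∈ subsetsOfCard A 2 then f ⟨_, hUV⟩ else ⟨0, hk⟩
  choose d hd using fun U => D.exists_fiber_mem (c U)
  obtain ⟨i, hi⟩ := D.exists_fiber_mem d
  let E : Set (Set Y) := A ∩ {U | d U = i}
  have hE : E ∈ D := inter_mem hAD hi
  -- The condition `U ∈ A` keeps `N U` in `D` even at positions no play reaches.
  let N : Set Y → Set (Set Y) := fun U => {V | U ∈ A → V ≠ U ∧ c U V = d U}
  have hN U : N U ∈ D := by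
    by_cases hU : U ∈ A
    · filter_upwards [hsing U hU, hd U] with V h₁ h₂ _ using ⟨h₁, h₂⟩
    · exact mem_of_superset univ_mem fun V _ hU' => (hU hU').elim
  have hL (l : List (Set Y)) : E ∩ ⋂ U ∈ {U | U ∈ l}, N U ∈ D :=
    inter_mem hE ((biInter_mem l.finite_toSet).2 fun U _ => hN U)
  let F : StrategyOne (openCovers Y) := fun l => ⟨E ∩ ⋂ U ∈ {U | U ∈ l}, N U,
    fun U hU => hA.1.1 U hU.1.1, eq_univ_of_forall fun y => by
      obtain ⟨U, hU, hy⟩ := D.nonempty_of_mem (inter_mem (hL l) (hpt y))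
      exact ⟨U, hU, hy⟩⟩
  obtain ⟨T, hT, hcov⟩ : ∃ T, F.IsPlay T ∧ range T ∈ openCoversOf X := by
    by_contra! hcon
    exact h ⟨F, hcon⟩
  have hTE n : T n ∈ E := (hT n).1
  have hTN {m n : ℕ} (hmn : m < n) : T n ≠ T m ∧ c (T m) (T n) = i := by
    have := mem_iInter₂.1 (hT n).2 (T m) (by simpa [List.mem_ofFn] using ⟨⟨m, hmn⟩, rfl⟩)
    exact ⟨(this (hTE m).1).1, (this (hTE m).1).2.trans (hTE m).2⟩
  have key {m n : ℕ} (hmn : m < n) (hs : ({T m, T n} : Finset (Set Y)) ∈ subsetsOfCard A 2) :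
      f ⟨_, hs⟩ = i := by
    have := (hTN hmn).2
    simpa only [c, dif_pos hs] using this
  refine ⟨range T, range_subset_iff.2 fun n => (hTE n).1, hcov, i, ?_⟩
  rintro ⟨s, hs⟩ ⟨hsT, hs2⟩
  obtain ⟨U, V, hUV, rfl⟩ := Finset.card_eq_two.1 hs2
  obtain ⟨m, rfl⟩ : U ∈ range T := hsT (by simp)
  obtain ⟨n, rfl⟩ : V ∈ range T := hsT (by simp)
  rcases lt_trichotomy m n with hmn | rfl | hmn
  · exact key hmn hs
  · exact (hUV rfl).elim
  · have hs' := hs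
    rw [Finset.pair_comm] at hs'
    rw [← key hmn hs']
    congr 2
    exact Finset.pair_comm _ _

/-! ### From the partition relation to boundedness -/

section TopologicalGroup

variable {G : Type*} [Group G] [TopologicalSpace G] [IsTopologicalGroup G]

/-- Either countably many translates of arbitrary neighborhoods cover `H` for the trivial reason
that `H` has finitely many points up to inseparability, or there are infinitely many pairwise
separable points in `H`. -/
theorem exists_translates_or_exists_separable {X : Set G} (W : ℕ → Set G)
    (hW : ∀ n, IsOpen (W n)) (h1 : ∀ n, (1 : G) ∈ W n) :
    (∃ g : ℕ → G, ∀ x ∈ X, ∃ n, x ∈ g n • W n) ∨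
      ∃ a : ℕ → G, (∀ n, a n ∈ X) ∧ ∀ m n, Inseparable (a m) (a n) → m = n := by
  by_cases hfin : (SeparationQuotient.mk '' X).Finite
  · left
    obtain rfl | hne := X.eq_empty_or_nonempty
    · exact ⟨1, by simp⟩
    obtain ⟨q, hq⟩ := hfin.countable.exists_eq_range (hne.image _)
    choose g hg using fun n => SeparationQuotient.surjective_mk (q n)
    refine ⟨g, fun x hx => ?_⟩
    obtain ⟨n, hn⟩ : SeparationQuotient.mk x ∈ range q := hq ▸ mem_image_of_mem _ hx
    rw [← hg n, SeparationQuotient.mk_eq_mk] at hn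
    exact ⟨n, (hn.mem_open_iff ((hW n).smul (g n))).1 ⟨1, h1 n, mul_one _⟩⟩
  · right
    let q := (show (SeparationQuotient.mk '' X).Infinite from hfin).natEmbedding
    choose a haX ha using fun n => (q n).2
    refine ⟨a, haX, fun m n hmn => q.injective (Subtype.ext ?_)⟩
    rw [← ha m, ← ha n]
    exact SeparationQuotient.mk_eq_mk.2 hmn

/-- The `ω`-cover formed by the unions `⋃ j, x j • W (l, j)` from which a point `a l` has been
removed. -/
theorem punctured_translates_mem_omegaCovers {W : ℕ → ℕ → Set G}
    (hW : ∀ l j, IsOpen (W l j)) (h1 : ∀ l j, (1 : G) ∈ W l j) {a : ℕ → G}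
    (ha : ∀ m n, Inseparable (a m) (a n) → m = n) :
    (range fun p : ℕ × (ℕ → G) => (closure {a p.1})ᶜ ∩ ⋃ j, p.2 j • W p.1 j) ∈
      omegaCovers G := by
  have hfin : ∀ F : Set G, F.Finite →
      ∃ U ∈ range fun p : ℕ × (ℕ → G) => (closure {a p.1})ᶜ ∩ ⋃ j, p.2 j • W p.1 j, F ⊆ U := by
    intro F hF
    -- Adding `1` makes the set nonempty, hence the range of a sequence.
    obtain ⟨x, hx⟩ := (hF.insert 1).countable.exists_eq_range (insert_nonempty _ _)
    have hbad : {l | ∃ y ∈ F, y ∈ closure {a l}}.Finite := by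
      have : {l | ∃ y ∈ F, y ∈ closure {a l}} = ⋃ y ∈ F, {l | y ∈ closure {a l}} := by
        ext; simp
      rw [this]
      refine hF.biUnion fun y _ => Set.Subsingleton.finite fun m hm n hn => ha m n ?_
      exact (specializes_iff_mem_closure.2 hm).inseparable.trans
        (specializes_iff_mem_closure.2 hn).inseparable.symm
    obtain ⟨l, hl⟩ := hbad.exists_notMem
    refine ⟨_, ⟨(l, x), rfl⟩, fun y hy => ⟨fun hyl => hl ⟨y, hy, hyl⟩, mem_iUnion.2 ?_⟩⟩
    obtain ⟨j, rfl⟩ : y ∈ range x := hx ▸ mem_insert_of_mem _ hy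
    exact ⟨j, 1, h1 l j, mul_one _⟩
  refine ⟨⟨?_, eq_univ_of_forall fun y => ?_⟩, ?_, hfin⟩
  · rintro _ ⟨p, rfl⟩
    exact isClosed_closure.isOpen_compl.inter (isOpen_iUnion fun j => (hW _ _).smul _)
  · obtain ⟨U, hU, hy⟩ := hfin {y} (finite_singleton y)
    exact ⟨U, hU, hy rfl⟩
  · rintro ⟨p, hp⟩
    exact (hp.ge (mem_univ (a p.1))).1 (subset_closure rfl)

theorem Subgroup.isRothbergerBounded_of_partitionRelation (H : Subgroup G)
    (h : PartitionRelation (omegaCovers G) (openCoversOf (H : Set G)) 2 2) :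
    IsRothbergerBounded H := by
  classical
  refine H.isRothbergerBounded_of_translates fun W hW h1 => ?_
  obtain hg | ⟨a, haH, ha⟩ := exists_translates_or_exists_separable (X := (H : Set G)) W hW h1
  · exact hg
  let P : ℕ × (ℕ → G) → Set G := fun p =>
    (_root_.closure {a p.1})ᶜ ∩ ⋃ j, p.2 j • W (Nat.pair p.1 j)
  have hΩ : range P ∈ omegaCovers G := punctured_translates_mem_omegaCovers
    (W := fun l j => W (Nat.pair l j)) (fun _ _ => hW _) (fun _ _ => h1 _) ha
  -- A set may have several indices; `q` fixes one.
  choose! q hq using fun U (hU : U ∈ range P) => hU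
  obtain ⟨B, hBA, ⟨-, hB⟩, i, hi⟩ := h _ hΩ fun s =>
    if ∃ U ∈ s.1, ∃ V ∈ s.1, (q U).1 ≠ (q V).1 then 1 else 0
  have hpair {U V : Set G} (hU : U ∈ B) (hV : V ∈ B) (hUV : U ≠ V) :
      ((q U).1 ≠ (q V).1 ↔ i = 1) := by
    have hs : ({U, V} : Finset (Set G)) ∈ subsetsOfCard B 2 :=
      ⟨by simp [insert_subset_iff, hU, hV], Finset.card_pair hUV⟩
    rw [← hi ⟨_, hs.1.trans hBA, hs.2⟩ hs]
    simp [eq_comm]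
  -- Color `1`: `B` has at most one member per index `l`, so one sequence of centers per `l`
  -- suffices. Color `0`: all members share `l` and omit `a l ∈ H`, so `B` does not cover `H`.
  by_cases hi1 : i = 1
  · have hinj {U V : Set G} (hU : U ∈ B) (hV : V ∈ B) (hUV : (q U).1 = (q V).1) : U = V := by
      by_contra hne
      exact (hpair hU hV hne).2 hi1 hUV
    have hsel (l : ℕ) : ∃ x : ℕ → G, ∀ U ∈ B, (q U).1 = l → (q U).2 = x := by
      by_cases hl : ∃ U ∈ B, (q U).1 = l
      · obtain ⟨U, hU, rfl⟩ := hl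
        exact ⟨(q U).2, fun V hV hVU => by rw [hinj hV hU hVU]⟩
      · exact ⟨1, fun U hU hUl => (hl ⟨U, hU, hUl⟩).elim⟩
    choose x hx using hsel
    refine ⟨fun n => x n.unpair.1 n.unpair.2, fun y hy => ?_⟩
    obtain ⟨U, hU, hyU⟩ := hB hy
    rw [← hq U (hBA hU)] at hyU
    obtain ⟨j, hj⟩ := mem_iUnion.1 hyU.2
    refine ⟨Nat.pair (q U).1 j, ?_⟩
    simpa only [Nat.unpair_pair, ← hx _ U hU rfl] using hj
  · obtain ⟨U, hU, -⟩ := hB H.one_mem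
    obtain ⟨V, hV, haV⟩ := hB (haH (q U).1)
    have hUV : (q U).1 = (q V).1 := by
      by_cases hne : U = V
      · rw [hne]
      · by_contra hcon
        exact hi1 ((hpair hU hV hne).1 hcon)
    rw [← hq V (hBA hV), hUV] at haV
    exact (haV.1 (_root_.subset_closure rfl)).elim

end TopologicalGroup

theorem corollary4 {G : Type*} [Group G] [TopologicalSpace G] [IsTopologicalGroup G]
    [SigmaCompactSpace G] (H : Subgroup G) :
    List.TFAE
      [ SelectOne (openCovers G) (openCoversOf (H : Set G)),
        IsRothbergerBounded H,
        ¬ OneHasWinningStrategy (openCovers G) (openCoversOf (H : Set G)),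
        ¬ OneHasWinningStrategy (nbdCovers H) (openCovers H),
        ∀ k : ℕ, 0 < k →
          PartitionRelation (omegaCovers G) (openCoversOf (H : Set G)) 2 k ] := by
  tfae_have 1 → 2 := H.isRothbergerBounded_of_selectOne
  tfae_have 2 → 3 := H.not_oneHasWinningStrategy_openCovers
  tfae_have 3 → 1 := selectOne_of_not_oneHasWinningStrategy
  tfae_have 2 → 4 := H.not_oneHasWinningStrategy_nbdCovers
  tfae_have 4 → 2 := selectOne_of_not_oneHasWinningStrategy
  tfae_have 3 → 5 := fun h k hk => partitionRelation_of_not_oneHasWinningStrategy h hk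
  tfae_have 5 → 2 := fun h => H.isRothbergerBounded_of_partitionRelation (h 2 two_pos)
  tfae_finish
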